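/- Let $(\log x_K, M)$ be one of the four pairs $$(10^3,\ 7.9074),\quad (10^4,\ 7.1157),\quad (10^5,\ 6.6260),\quad (10^6,\ 6.2904).$$ Let $x \ge x_K$ be half an odd integer (that is, $x = k/2$ with $k$ an odd integer), and let $c = 1 + 1/\log x$. Then the series below converges and $$\sum_{n=1}^{\infty} \Lambda(n)\left(\frac{x}{n}\right)^{c}\left|\log\frac{x}{n}\right|^{-1} < M\, x \log x\, \log\log x,$$ where $\Lambda$ is the von Mangoldt function. -/

import Mathlib

/-- The admissible pairs `(log x_K, M)`. -/
def admissiblePairs : Set (ℝ × ℝ) :=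
  {(10 ^ 3, 7.9074), (10 ^ 4, 7.1157), (10 ^ 5, 6.6260), (10 ^ 6, 6.2904)}

/-- `x` is half an odd integer. -/
def IsHalfOddInteger (x : ℝ) : Prop :=
  ∃ k : ℤ, Odd k ∧ x = (k : ℝ) / 2

/-- The `n`-th term `Λ(n) (x/n)^c |log (x/n)|⁻¹` of the series. It is `0` at `n = 0`, as `Λ 0 = 0`,
so that summing it over `ℕ` is summing it over `n ≥ 1`. -/
noncomputable def perronErrorTerm (x c : ℝ) (n : ℕ) : ℝ :=
  ArithmeticFunction.vonMangoldt n * (x / n) ^ c * |Real.log (x / n)|⁻¹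

/-! Split the series at distance comparable to `x`. If `n ≤ x/2` or `n ≥ 2x`, then `|log (x/n)| ≥
log 2`, and these terms contribute at most `x^c / log 2` times `∑ Λ(n)/n^c`. Here `x^c = e x`, and
the Dirichlet series is `-ζ'/ζ` at `1 + 1/log x`, which is `O(log x)`
(`tsum_vonMangoldt_div_rpow_le`).

The main term comes from `n` near `x`, where a prime power `n` contributes about `x log x / |x -
n|`. Since `x` is half an odd integer, `|x - n| = j + 1/2` with `j` a natural number. Summing over
all `j` would give `x (log x)^2`, so the sparsity of prime powers is needed at every scale around
`x`. Selberg's sieve (`card_sifted_le`) gives a Brun–Titchmarsh bound, with main term `(5/2) m / log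
m` for `m` consecutive integers wherever they lie (`card_isPrimePow_le`). Partial summation
(`sum_div_add_half_le`) turns this into `(5/2) log log x` on each side of `x`.

The total is `x (log x + 1) (5 log log x + 17.2)`. Every admissible `M` exceeds 5 by enough to
absorb the constant, because `log log x ≥ log L`, where `L` is the first entry of the pair. -/

namespace SelbergWeights

open Finset ArithmeticFunction

/-! ### Selberg's weights: the minimum of the quadratic form and the bound by 1 -/

/-- The squarefree integers in `[1, D]`. -/
def support (D : ℕ) : Finset ℕ := (Icc 1 D).filter Squarefree

/-- The sum of `1 / φ d` over squarefree `d ≤ D`. -/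
noncomputable def mass (D : ℕ) : ℝ := ∑ d ∈ support D, 1 / (d.totient : ℝ)

/-- Selberg's optimal sieve weights of level `D`. -/
noncomputable def weight (D d : ℕ) : ℝ :=
  d * ∑ f ∈ (support D).filter (d ∣ ·),
    (moebius (f / d) : ℝ) * ((moebius f : ℝ) / (f.totient * mass D))

lemma mem_support {D d : ℕ} : d ∈ support D ↔ 1 ≤ d ∧ d ≤ D ∧ Squarefree d := by
  simp [support, and_assoc]

lemma mem_support_of_dvd {D d f : ℕ} (hf : f ∈ support D) (h : d ∣ f) : d ∈ support D := by
  rw [mem_support] at *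
  exact ⟨Nat.pos_of_dvd_of_pos h hf.1, (Nat.le_of_dvd hf.1 h).trans hf.2.1,
    hf.2.2.squarefree_of_dvd h⟩

lemma one_mem_support {D : ℕ} (hD : 1 ≤ D) : 1 ∈ support D := by
  simp [mem_support, hD]

lemma totient_pos_of_mem {D d : ℕ} (hd : d ∈ support D) : 0 < (d.totient : ℝ) := by
  exact_mod_cast Nat.totient_pos.2 (mem_support.1 hd).1

lemma mass_pos {D : ℕ} (hD : 1 ≤ D) : 0 < mass D :=
  sum_pos (fun _ hd => one_div_pos.2 (totient_pos_of_mem hd)) ⟨1, one_mem_support hD⟩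

lemma sum_moebius_divisors {n : ℕ} :
    ∑ k ∈ n.divisors, (moebius k : ℝ) = if n = 1 then 1 else 0 := by
  have h : ((moebius * zeta : ArithmeticFunction ℤ)) n = (1 : ArithmeticFunction ℤ) n := by
    rw [moebius_mul_coe_zeta]
  rw [coe_mul_zeta_apply, one_apply] at h
  exact_mod_cast h

/-- The substitution `k = f / d` reduces this to the Möbius sum over the divisors of `f / e`. -/
lemma sum_moebius_div {e f : ℕ} (hf : f ≠ 0) (hef : e ∣ f) :
    ∑ d ∈ f.divisors.filter (e ∣ ·), (moebius (f / d) : ℝ) = if f = e then 1 else 0 := by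
  have he : e ≠ 0 := ne_zero_of_dvd_ne_zero hf hef
  have h1 : ∑ d ∈ f.divisors.filter (e ∣ ·), (moebius (f / d) : ℝ)
      = ∑ k ∈ (f / e).divisors, (moebius k : ℝ) := by
    refine sum_nbij' (fun d => f / d) (fun k => f / k) ?_ ?_ ?_ ?_ ?_
    · intro d hd
      simp only [mem_filter, Nat.mem_divisors] at hd ⊢
      obtain ⟨⟨⟨a, rfl⟩, -⟩, ⟨b, rfl⟩⟩ := hd
      have hb : b ≠ 0 := by rintro rfl; simp at hf
      have ha : a ≠ 0 := by rintro rfl; simp at hf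
      rw [Nat.mul_div_cancel_left _ (by positivity), mul_assoc,
        Nat.mul_div_cancel_left _ (by positivity)]
      exact ⟨Dvd.intro_left _ rfl, by positivity⟩
    · intro k hk
      simp only [mem_filter, Nat.mem_divisors] at hk ⊢
      obtain ⟨a, rfl⟩ := hef
      rw [Nat.mul_div_cancel_left _ (by positivity)] at hk
      obtain ⟨⟨b, rfl⟩, hb⟩ := hk
      have hk0 : 0 < k := Nat.pos_of_ne_zero (by rintro rfl; simp at hb)
      rw [mul_left_comm, Nat.mul_div_cancel_left _ hk0]
      exact ⟨⟨Dvd.intro_left _ rfl, by rwa [mul_left_comm] at hf⟩, Dvd.intro _ rfl⟩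
    · intro d hd
      simp only [mem_filter, Nat.mem_divisors] at hd
      exact Nat.div_div_self hd.1.1 hf
    · intro k hk
      simp only [Nat.mem_divisors] at hk
      exact Nat.div_div_self (hk.1.trans (Nat.div_dvd_of_dvd hef)) hf
    · intro d _; rfl
  rw [h1, sum_moebius_divisors]
  congr 1
  rw [Nat.div_eq_iff_eq_mul_left (Nat.pos_of_ne_zero he) hef, one_mul]

/-- Dual Möbius inversion of the definition of `weight`. These sums are the coordinates in which the
sieve's quadratic form is diagonal. -/
lemma sum_weight_div {D e : ℕ} (he : e ∈ support D) :
    ∑ d ∈ (support D).filter (e ∣ ·), weight D d / d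
      = (moebius e : ℝ) / (e.totient * mass D) := by
  have h1 : ∀ d ∈ (support D).filter (e ∣ ·), weight D d / d
      = ∑ f ∈ support D, if d ∣ f then
        (moebius (f / d) : ℝ) * ((moebius f : ℝ) / (f.totient * mass D)) else 0 := by
    intro d hd
    have hd0 : (d : ℝ) ≠ 0 := by
      have := (mem_support.1 (mem_filter.1 hd).1).1
      positivity
    rw [weight, mul_div_cancel_left₀ _ hd0, sum_filter]
  rw [sum_congr rfl h1, sum_comm]
  have h2 : ∀ f ∈ support D, (∑ d ∈ (support D).filter (e ∣ ·), if d ∣ f then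
        (moebius (f / d) : ℝ) * ((moebius f : ℝ) / (f.totient * mass D)) else 0)
      = if f = e then (moebius f : ℝ) / (f.totient * mass D) else 0 := by
    intro f hf
    have hf0 : f ≠ 0 := by have := (mem_support.1 hf).1; omega
    rw [← sum_filter, filter_filter, ← sum_mul]
    have h3 : (support D).filter (fun d => e ∣ d ∧ d ∣ f) = f.divisors.filter (e ∣ ·) := by
      ext d
      simp only [mem_filter, Nat.mem_divisors]
      exact ⟨fun h => ⟨⟨h.2.2, hf0⟩, h.2.1⟩,
        fun h => ⟨mem_support_of_dvd hf h.1.1, h.2, h.1.1⟩⟩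
    rw [h3]
    by_cases hef : e ∣ f
    · rw [sum_moebius_div hf0 hef]
      split_ifs <;> simp
    · have h4 : f.divisors.filter (e ∣ ·) = ∅ := by
        refine filter_eq_empty_iff.2 fun d hd hed => hef (hed.trans (Nat.dvd_of_mem_divisors hd))
      rw [h4, sum_empty, zero_mul, if_neg]
      rintro rfl
      exact hef dvd_rfl
  rw [sum_congr rfl h2, sum_ite_eq' _ _ _, if_pos he]

lemma moebius_sq_of_mem {D d : ℕ} (hd : d ∈ support D) : (moebius d : ℝ) ^ 2 = 1 := by
  exact_mod_cast moebius_sq_eq_one_of_squarefree (mem_support.1 hd).2.2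

lemma weight_one {D : ℕ} (hD : 1 ≤ D) : weight D 1 = 1 := by
  have hm := mass_pos hD
  rw [weight, Nat.cast_one, one_mul]
  have h : ∀ f ∈ (support D).filter (1 ∣ ·),
      (moebius (f / 1) : ℝ) * ((moebius f : ℝ) / (f.totient * mass D))
        = 1 / (f.totient : ℝ) * (1 / mass D) := by
    intro f hf
    have h1 := moebius_sq_of_mem (mem_filter.1 hf).1
    have h2 := totient_pos_of_mem (mem_filter.1 hf).1
    rw [Nat.div_one]
    field_simp
    linarith
  rw [sum_congr rfl h, ← sum_mul, filter_true_of_mem (fun _ _ => one_dvd _), ← mass]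
  field_simp

/-- Writing `1 / lcm = gcd / (d d')` and `gcd = ∑ φ(e)` over common divisors `e` diagonalises the
form. By `sum_weight_div` each `e` then contributes `1 / (φ(e) mass²)`. -/
lemma sum_weight_lcm {D : ℕ} (hD : 1 ≤ D) :
    ∑ d ∈ support D, ∑ d' ∈ support D, weight D d * weight D d' / (d.lcm d' : ℝ)
      = 1 / mass D := by
  have hm := mass_pos hD
  have h1 : ∀ d ∈ support D, ∀ d' ∈ support D, weight D d * weight D d' / (d.lcm d' : ℝ)
      = ∑ e ∈ support D, (e.totient : ℝ) * ((if e ∣ d then weight D d / d else 0)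
        * (if e ∣ d' then weight D d' / d' else 0)) := by
    intro d hd d' hd'
    have p1 := (mem_support.1 hd).1
    have p2 := (mem_support.1 hd').1
    have hg : ((d.gcd d' : ℕ) : ℝ) = ∑ e ∈ support D, if e ∣ d ∧ e ∣ d' then (e.totient : ℝ) else 0 := by
      rw [← sum_filter]
      conv_lhs => rw [← Nat.sum_totient (d.gcd d')]
      push_cast
      refine sum_congr ?_ fun _ _ => rfl
      ext e
      simp only [Nat.mem_divisors, mem_filter, Nat.dvd_gcd_iff]
      exact ⟨fun h => ⟨mem_support_of_dvd hd h.1.1, h.1⟩,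
        fun h => ⟨h.2, (Nat.gcd_pos_of_pos_left _ p1).ne'⟩⟩
    have hl : ((d.gcd d' : ℕ) : ℝ) * (d.lcm d' : ℕ) = d * d' := by
      exact_mod_cast Nat.gcd_mul_lcm d d'
    have hl0 : ((d.lcm d' : ℕ) : ℝ) ≠ 0 := by
      exact_mod_cast (Nat.lcm_pos p1 p2).ne'
    have q1 : (d : ℝ) ≠ 0 := by positivity
    have q2 : (d' : ℝ) ≠ 0 := by positivity
    have h2 : weight D d * weight D d' / (d.lcm d' : ℝ)
        = ((d.gcd d' : ℕ) : ℝ) * (weight D d / d * (weight D d' / d')) := by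
      field_simp
      linear_combination (-(weight D d * weight D d')) * hl
    rw [h2, hg, sum_mul]
    refine sum_congr rfl fun e _ => ?_
    by_cases a : e ∣ d <;> by_cases b : e ∣ d' <;> simp [a, b]
  rw [sum_congr rfl fun d hd => sum_congr rfl (h1 d hd)]
  have h3 : ∀ d ∈ support D, (∑ d' ∈ support D, ∑ e ∈ support D,
      (e.totient : ℝ) * ((if e ∣ d then weight D d / d else 0)
        * (if e ∣ d' then weight D d' / d' else 0)))
      = ∑ e ∈ support D, (e.totient : ℝ) * ((if e ∣ d then weight D d / d else 0)
        * ∑ d' ∈ support D, (if e ∣ d' then weight D d' / d' else 0)) := by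
    intro d _
    rw [sum_comm]
    simp only [mul_sum]
  rw [sum_congr rfl h3, sum_comm]
  have h4 : ∀ e ∈ support D, (∑ d ∈ support D, (e.totient : ℝ) *
      ((if e ∣ d then weight D d / d else 0)
        * ∑ d' ∈ support D, (if e ∣ d' then weight D d' / d' else 0)))
      = 1 / (e.totient : ℝ) * (1 / mass D ^ 2) := by
    intro e he
    rw [← mul_sum, ← sum_mul, ← sum_filter, sum_weight_div he]
    have := moebius_sq_of_mem he
    have := totient_pos_of_mem he
    field_simp
    linarith
  rw [sum_congr rfl h4, ← sum_mul, ← mass]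
  field_simp

/-- Expand `d = ∑ φ(g)` over `g ∣ d` and use `φ(g) / φ(f) = 1 / φ(f/g)`, valid as `f` is squarefree.
The pairs `(f, g)` inject into `support D` by `f / g`: its gcd with `d` is `d / g`, which recovers
`g` and then `f`. -/
lemma mul_sum_le_mass {D d : ℕ} (hd : d ∈ support D) :
    (d : ℝ) * ∑ f ∈ (support D).filter (d ∣ ·), 1 / (f.totient : ℝ) ≤ mass D := by
  have hd1 := (mem_support.1 hd).1
  have key : ∀ f ∈ (support D).filter (d ∣ ·), ∀ g ∈ d.divisors,
      (f / g).Coprime g ∧ g * (f / g) = f ∧ (f / g).gcd d = d / g := by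
    intro f hf g hg
    rw [mem_filter] at hf
    have hgd := Nat.dvd_of_mem_divisors hg
    obtain ⟨a, rfl⟩ := hgd
    obtain ⟨b, rfl⟩ := hf.2
    have hg0 : 0 < g := Nat.pos_of_ne_zero (by rintro rfl; simp at hd1)
    have hsq := (mem_support.1 hf.1).2.2
    rw [mul_assoc] at hsq ⊢
    rw [Nat.mul_div_cancel_left _ hg0, Nat.mul_div_cancel_left _ hg0]
    have hc := Nat.coprime_of_squarefree_mul hsq
    refine ⟨hc.symm, rfl, ?_⟩
    rw [Nat.Coprime.gcd_mul_left_cancel_right _ hc]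
    exact Nat.gcd_eq_right (Dvd.intro _ rfl)
  have h1 : (d : ℝ) * ∑ f ∈ (support D).filter (d ∣ ·), 1 / (f.totient : ℝ)
      = ∑ q ∈ (support D).filter (d ∣ ·) ×ˢ d.divisors, 1 / ((q.1 / q.2).totient : ℝ) := by
    rw [sum_product, mul_sum]
    refine sum_congr rfl fun f hf => ?_
    conv_lhs => rw [← Nat.sum_totient d]
    push_cast
    rw [sum_mul]
    refine sum_congr rfl fun g hg => ?_
    obtain ⟨k1, k2, -⟩ := key f hf g hg
    have h2 : (f.totient : ℝ) = g.totient * (f / g).totient := by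
      rw [← Nat.cast_mul, ← Nat.totient_mul k1.symm, k2]
    have h3 : (g.totient : ℝ) ≠ 0 := by
      have := Nat.totient_pos.2 (Nat.pos_of_mem_divisors hg)
      positivity
    rw [h2, one_div, mul_inv, ← mul_assoc, mul_inv_cancel₀ h3, one_mul, one_div]
  rw [h1, mass, ← sum_image (f := fun m : ℕ => 1 / (m.totient : ℝ))
    (g := fun q : ℕ × ℕ => q.1 / q.2)]
  · refine sum_le_sum_of_subset_of_nonneg ?_ fun _ _ _ => by positivity
    intro m hm
    rw [mem_image] at hm
    obtain ⟨q, hq, rfl⟩ := hm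
    rw [mem_product] at hq
    obtain ⟨-, k2, -⟩ := key _ hq.1 _ hq.2
    exact mem_support_of_dvd (mem_filter.1 hq.1).1 (Dvd.intro_left _ k2)
  · rintro ⟨f, g⟩ hq ⟨f', g'⟩ hq' h
    simp only [mem_coe, mem_product] at hq hq'
    obtain ⟨-, k2, k3⟩ := key _ hq.1 _ hq.2
    obtain ⟨-, l2, l3⟩ := key _ hq'.1 _ hq'.2
    simp only at h
    have hgg : g = g' := by
      rw [← Nat.div_div_self (Nat.dvd_of_mem_divisors hq.2) (by omega), ← k3, h, l3,
        Nat.div_div_self (Nat.dvd_of_mem_divisors hq'.2) (by omega)]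
    subst hgg
    rw [← k2, ← l2, h]

lemma abs_weight_le_one {D d : ℕ} (hD : 1 ≤ D) (hd : d ∈ support D) : |weight D d| ≤ 1 := by
  have hm := mass_pos hD
  have hb : ∀ n : ℕ, |(moebius n : ℝ)| ≤ 1 := fun n => by
    exact_mod_cast abs_moebius_le_one
  rw [weight, abs_mul, Nat.abs_cast]
  calc (d : ℝ) * |∑ f ∈ (support D).filter (d ∣ ·),
        (moebius (f / d) : ℝ) * ((moebius f : ℝ) / (f.totient * mass D))|
      ≤ d * ∑ f ∈ (support D).filter (d ∣ ·), 1 / (f.totient : ℝ) * (1 / mass D) := by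
        refine mul_le_mul_of_nonneg_left ((abs_sum_le_sum_abs _ _).trans
          (sum_le_sum fun f hf => ?_)) (Nat.cast_nonneg _)
        have := totient_pos_of_mem (mem_filter.1 hf).1
        rw [abs_mul, abs_div, abs_of_pos (mul_pos this hm), one_div_mul_one_div]
        calc _ ≤ 1 * (1 / (f.totient * mass D)) := by gcongr <;> exact hb _
          _ = _ := one_mul _
    _ ≤ mass D * (1 / mass D) := by
        rw [← sum_mul, ← mul_assoc]
        exact mul_le_mul_of_nonneg_right (mul_sum_le_mass hd) (by positivity)
    _ = 1 := by field_simp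

end SelbergWeights

/-! ### Lower bound for `mass` and the sieve inequality -/

namespace SelbergWeights

open Finset ArithmeticFunction

/-- A finite part of the Euler product over the primes in `s`. -/
lemma sum_inv_le_of_mem_factoredNumbers {s t : Finset ℕ} (ht : ∀ m ∈ t, m ∈ Nat.factoredNumbers s) :
    ∑ m ∈ t, (1 / m : ℝ) ≤ ∏ p ∈ s with p.Prime, (1 - (p : ℝ)⁻¹)⁻¹ := by
  let f : ℕ →* ℝ :=
    { toFun := fun n => (n : ℝ)⁻¹, map_one' := by simp, map_mul' := fun a b => by simp [mul_comm] }
  have h := EulerProduct.summable_and_hasSum_factoredNumbers_prod_filter_prime_geometric (f := f)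
    (fun {p} hp => by
      change ‖((p : ℝ)⁻¹)‖ < 1
      rw [norm_inv, Real.norm_natCast]
      exact inv_lt_one_of_one_lt₀ (by exact_mod_cast hp.one_lt)) s
  have h2 := sum_le_hasSum (t.subtype (· ∈ Nat.factoredNumbers s)) (fun i _ => by
    change 0 ≤ ((i : ℕ) : ℝ)⁻¹
    positivity) h.2
  refine le_trans (le_of_eq ?_) h2
  change _ = ∑ i ∈ t.subtype (· ∈ Nat.factoredNumbers s), ((i : ℕ) : ℝ)⁻¹
  rw [sum_subtype_eq_sum_filter (f := fun i : ℕ => (i : ℝ)⁻¹), filter_true_of_mem ht]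
  simp

/-- If `n` has radical `d`, then `n / d` is composed of primes dividing `d`, and `1/φ(d)` is `1/d`
times the Euler product over those primes. -/
lemma sum_inv_le_inv_totient (D d : ℕ) (hd : d ∈ support D) :
    ∑ n ∈ (Icc 1 D).filter (fun n => ∏ p ∈ n.primeFactors, p = d), (1 / n : ℝ)
      ≤ 1 / (d.totient : ℝ) := by
  have hd1 := (mem_support.1 hd).1
  have hd0 : (d : ℝ) ≠ 0 := by positivity
  have hφ : (d.totient : ℝ) = d * ∏ p ∈ d.primeFactors, (1 - (p : ℝ)⁻¹) := by
    have h := congrArg (Rat.cast : ℚ → ℝ) (Nat.totient_eq_mul_prod_factors d)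
    push_cast at h
    exact h
  have key : ∀ n ∈ (Icc 1 D).filter (fun n => ∏ p ∈ n.primeFactors, p = d),
      d ∣ n ∧ n ≠ 0 ∧ n.primeFactors = d.primeFactors := by
    intro n hn
    rw [mem_filter, mem_Icc] at hn
    have h0 : n ≠ 0 := by omega
    refine ⟨hn.2 ▸ Nat.prod_primeFactors_dvd n, h0, ?_⟩
    rw [← hn.2, Nat.primeFactors_prod fun p hp => Nat.prime_of_mem_primeFactors hp]
  have h1 : ∑ n ∈ (Icc 1 D).filter (fun n => ∏ p ∈ n.primeFactors, p = d), (1 / n : ℝ)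
      = (1 / d) * ∑ m ∈ ((Icc 1 D).filter
        (fun n => ∏ p ∈ n.primeFactors, p = d)).image (· / d), (1 / m : ℝ) := by
    rw [sum_image, mul_sum]
    · refine sum_congr rfl fun n hn => ?_
      obtain ⟨⟨a, rfl⟩, -, -⟩ := key n hn
      rw [Nat.mul_div_cancel_left _ hd1]
      push_cast
      rw [one_div_mul_one_div]
    · intro n hn n' hn' h
      obtain ⟨⟨a, rfl⟩, -, -⟩ := key n hn
      obtain ⟨⟨b, rfl⟩, -, -⟩ := key n' hn'
      simp only [Nat.mul_div_cancel_left _ hd1] at h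
      rw [h]
  have h2 : ∑ m ∈ ((Icc 1 D).filter
        (fun n => ∏ p ∈ n.primeFactors, p = d)).image (· / d), (1 / m : ℝ)
        ≤ ∏ p ∈ d.primeFactors with p.Prime, (1 - (p : ℝ)⁻¹)⁻¹ := by
    refine sum_inv_le_of_mem_factoredNumbers fun m hm => ?_
    rw [mem_image] at hm
    obtain ⟨n, hn, rfl⟩ := hm
    obtain ⟨⟨a, rfl⟩, h0, hp⟩ := key n hn
    have ha : a ≠ 0 := by rintro rfl; simp at h0
    rw [Nat.mul_div_cancel_left _ hd1, Nat.mem_factoredNumbers_iff_primeFactors_subset, ← hp]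
    exact ⟨ha, Nat.primeFactors_mono (Dvd.intro_left _ rfl) h0⟩
  rw [filter_true_of_mem fun p hp => Nat.prime_of_mem_primeFactors hp] at h2
  rw [h1, hφ, one_div, one_div, mul_inv, ← prod_inv_distrib]
  exact mul_le_mul_of_nonneg_left h2 (by positivity)

/-- Group the harmonic sum up to `D` by radical; each class is bounded by one term of `mass D`. -/
lemma log_le_mass (D : ℕ) : Real.log (D + 1) ≤ mass D := by
  have h1 := log_add_one_le_harmonic D
  rw [harmonic_eq_sum_Icc] at h1
  push_cast at h1
  refine h1.trans ?_
  rw [mass, ← sum_fiberwise_of_maps_to (s := Icc 1 D) (t := support D)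
    (g := fun n => ∏ p ∈ n.primeFactors, p)]
  · refine sum_le_sum fun d hd => ?_
    simpa using sum_inv_le_inv_totient D d hd
  · intro n hn
    rw [mem_Icc] at hn
    have hdvd := Nat.prod_primeFactors_dvd n
    refine mem_support.2 ⟨Nat.pos_of_dvd_of_pos hdvd hn.1, (Nat.le_of_dvd hn.1 hdvd).trans hn.2, ?_⟩
    refine squarefree_prod_of_pairwise_isCoprime (fun p hp q hq hpq => ?_)
      fun p hp => (Nat.prime_of_mem_primeFactors hp).squarefree
    exact Nat.coprime_iff_isRelPrime.1 ((Nat.coprime_primes (Nat.prime_of_mem_primeFactors hp)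
      (Nat.prime_of_mem_primeFactors hq)).2 hpq)

lemma abs_card_filter_dvd_sub (a m r : ℕ) (hr : 0 < r) :
    |(((Ico a (a + m)).filter (r ∣ ·)).card : ℝ) - m / r| ≤ 1 := by
  have h := Nat.Ico_filter_modEq_card a (a + m) hr 0
  simp only [Nat.modEq_zero_iff_dvd] at h
  have hr' : (0 : ℚ) < r := by exact_mod_cast hr
  set u : ℚ := ((a + m : ℕ) - (0 : ℕ)) / (r : ℚ) with hu
  set v : ℚ := (a - (0 : ℕ)) / (r : ℚ) with hv
  have huv : u - v = m / r := by
    rw [hu, hv]; push_cast; field_simp; ring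
  have hle : v ≤ u := by
    have : (0 : ℚ) ≤ m / r := by positivity
    linarith
  rw [max_eq_left (sub_nonneg.2 (Int.ceil_mono hle))] at h
  have hq : (((Ico a (a + m)).filter (r ∣ ·)).card : ℚ) = (⌈u⌉ : ℚ) - ⌈v⌉ := by
    exact_mod_cast h
  have h1 := Int.le_ceil u
  have h2 := Int.ceil_lt_add_one u
  have h3 := Int.le_ceil v
  have h4 := Int.ceil_lt_add_one v
  have h5 : |(((Ico a (a + m)).filter (r ∣ ·)).card : ℚ) - m / r| ≤ 1 := by
    rw [abs_le]; constructor <;> linarith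
  have h6 : ((|(((Ico a (a + m)).filter (r ∣ ·)).card : ℚ) - m / r| : ℚ) : ℝ) ≤ (1 : ℚ) :=
    Rat.cast_le.2 h5
  push_cast at h6
  exact h6

open scoped Classical in
-- For a sifted `n` only `d = 1` survives, with weight 1; every other square is nonnegative.
lemma card_le_sum_weight {D : ℕ} (hD : 1 ≤ D) (I : Finset ℕ) :
    ((I.filter fun n => ∀ p, p.Prime → p ≤ D → ¬ p ∣ n).card : ℝ)
      ≤ ∑ n ∈ I, (∑ d ∈ support D, if d ∣ n then weight D d else 0) ^ 2 := by
  rw [card_filter]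
  push_cast
  refine sum_le_sum fun n _ => ?_
  split_ifs with h
  · rw [sum_eq_single 1]
    · simp [weight_one hD]
    · intro d hd hd1
      rw [if_neg]
      intro hdn
      obtain ⟨p, hp, hpd⟩ := Nat.exists_prime_and_dvd hd1
      have h2 := mem_support.1 hd
      exact h p hp ((Nat.le_of_dvd h2.1 hpd).trans h2.2.1) (hpd.trans hdn)
    · exact fun h1 => absurd (one_mem_support hD) h1
  · positivity

open scoped Classical in
/-- Selberg's upper bound sieve for an interval of `m` consecutive integers. -/
theorem card_sifted_le {D : ℕ} (hD : 1 ≤ D) (a m : ℕ) :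
    (((Ico a (a + m)).filter fun n => ∀ p, p.Prime → p ≤ D → ¬ p ∣ n).card : ℝ)
      ≤ m / Real.log (D + 1) + D ^ 2 := by
  refine (card_le_sum_weight hD _).trans ?_
  have h1 : ∑ n ∈ Ico a (a + m), (∑ d ∈ support D, if d ∣ n then weight D d else 0) ^ 2
      = ∑ d ∈ support D, ∑ d' ∈ support D, weight D d * weight D d'
        * ((Ico a (a + m)).filter (d.lcm d' ∣ ·)).card := by
    simp_rw [sq, sum_mul_sum]
    rw [sum_comm]
    refine sum_congr rfl fun d _ => ?_
    rw [sum_comm]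
    refine sum_congr rfl fun d' _ => ?_
    rw [card_filter]
    push_cast
    rw [mul_sum]
    refine sum_congr rfl fun n _ => ?_
    simp only [Nat.lcm_dvd_iff]
    by_cases h : d ∣ n <;> by_cases h' : d' ∣ n <;> simp [h, h']
  have h2 : ∀ d ∈ support D, ∀ d' ∈ support D, weight D d * weight D d'
        * (((Ico a (a + m)).filter (d.lcm d' ∣ ·)).card : ℝ)
      ≤ m * (weight D d * weight D d' / (d.lcm d' : ℝ)) + 1 := by
    intro d hd d' hd'
    have hl := Nat.lcm_pos (mem_support.1 hd).1 (mem_support.1 hd').1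
    have h3 := abs_card_filter_dvd_sub a m _ hl
    set c := (((Ico a (a + m)).filter (d.lcm d' ∣ ·)).card : ℝ)
    -- Each pair `(d, d')` costs an error of at most 1, hence `D ^ 2` in total.
    have h4 : |weight D d * weight D d' * (c - m / (d.lcm d' : ℕ))| ≤ 1 := by
      rw [abs_mul, abs_mul]
      exact mul_le_one₀ (mul_le_one₀ (abs_weight_le_one hD hd) (abs_nonneg _)
        (abs_weight_le_one hD hd')) (abs_nonneg _) h3
    have h5 := (abs_le.1 h4).2
    have h6 : weight D d * weight D d' * (c - m / (d.lcm d' : ℕ)) = weight D d * weight D d' * c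
      - m * (weight D d * weight D d' / (d.lcm d' : ℝ)) := by ring
    linarith
  rw [h1]
  refine (sum_le_sum fun d hd => sum_le_sum (h2 d hd)).trans ?_
  simp only [sum_add_distrib, ← mul_sum, sum_weight_lcm hD, sum_const, nsmul_eq_mul, mul_one]
  have hlog : 0 < Real.log (D + 1) := Real.log_pos (by
    have : (1 : ℝ) ≤ D := by exact_mod_cast hD
    linarith)
  have hc : ((support D).card : ℝ) ≤ D := by
    exact_mod_cast (card_filter_le _ _).trans (by simp)
  have h7 : (m : ℝ) * (1 / mass D) ≤ m / Real.log (D + 1) := by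
    rw [mul_one_div]
    gcongr
    exact log_le_mass D
  nlinarith [Nat.cast_nonneg (α := ℝ) (support D).card]

end SelbergWeights

/-! ### Prime powers in short intervals -/

open Finset

open scoped Classical in
-- A prime power not sifted out is a power of some prime `p ≤ D`. Since `a + m ≤ 2 a` and
-- consecutive powers of `p` differ by a factor of at least 2, each `p` occurs at most once.
lemma card_isPrimePow_le_add (a m D : ℕ) (ham : m ≤ a) :
    ((Ico a (a + m)).filter IsPrimePow).card
      ≤ ((Ico a (a + m)).filter fun n => ∀ p, p.Prime → p ≤ D → ¬ p ∣ n).card + D := by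
  set S := (Ico a (a + m)).filter fun n => ∀ p, p.Prime → p ≤ D → ¬ p ∣ n
  set R := (Ico a (a + m)).filter fun n => IsPrimePow n ∧ n.minFac ≤ D
  have h1 : (Ico a (a + m)).filter IsPrimePow ⊆ S ∪ R := by
    intro n hn
    rw [mem_filter] at hn
    rw [mem_union]
    by_cases h : n.minFac ≤ D
    · exact Or.inr (mem_filter.2 ⟨hn.1, hn.2, h⟩)
    · refine Or.inl (mem_filter.2 ⟨hn.1, fun p hp hpD hpn => h ?_⟩)
      exact (Nat.minFac_le_of_dvd hp.two_le hpn).trans hpD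
  have h2 : R.card ≤ (Icc 1 D).card := by
    refine card_le_card_of_injOn Nat.minFac ?_ ?_
    · intro n hn
      have h := (mem_filter.1 (mem_coe.1 hn)).2.2
      exact mem_coe.2 (mem_Icc.2 ⟨Nat.minFac_pos n, h⟩)
    · have hlt : ∀ n ∈ R, ∀ n' ∈ R, n.minFac = n'.minFac → n ≤ n' := by
        intro n hn n' hn' h
        obtain ⟨hI, hp, -⟩ := mem_filter.1 hn
        obtain ⟨hI', hp', -⟩ := mem_filter.1 hn'
        rw [mem_Ico] at hI hI'
        have e1 := hp.minFac_pow_factorization_eq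
        have e2 := hp'.minFac_pow_factorization_eq
        have hprime := Nat.minFac_prime hp.ne_one
        rw [← h] at e2
        set k := n.factorization n.minFac
        set k' := n'.factorization n.minFac
        by_contra hlt
        have hkk : k' < k := by
          by_contra hk
          have := Nat.pow_le_pow_right hprime.pos (not_lt.1 hk)
          omega
        have h3 : n.minFac ^ (k' + 1) ≤ n.minFac ^ k := Nat.pow_le_pow_right hprime.pos hkk
        rw [pow_succ, e1, e2] at h3
        have h4 := Nat.mul_le_mul_left n' hprime.two_le
        omega
      intro n hn n' hn' h
      exact le_antisymm (hlt n hn n' hn' h) (hlt n' hn' n hn h.symm)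
  calc _ ≤ (S ∪ R).card := card_le_card h1
    _ ≤ S.card + R.card := card_union_le _ _
    _ ≤ _ := by simpa using h2

open scoped Classical in
/-- A Brun–Titchmarsh type bound for prime powers in a short interval. -/
theorem card_isPrimePow_le {a m : ℕ} (hm : 400 ≤ m) (ham : m ≤ a) :
    (((Ico a (a + m)).filter IsPrimePow).card : ℝ)
      ≤ 5 / 2 * (m / Real.log m) + 11 / 10 * (m : ℝ) ^ (4 / 5 : ℝ) := by
  have hm' : (400 : ℝ) ≤ m := by exact_mod_cast hm
  have hm0 : (0 : ℝ) < m := by linarith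
  -- The level `m^(2/5)` gives the factor `5/2` and the error `m^(4/5)`. The extra `D ≤ z` is at
  -- most `z² / 10`, as `z ≥ 10` for `m ≥ 400`; hence `11/10`.
  set z : ℝ := (m : ℝ) ^ (2 / 5 : ℝ) with hz
  have hz2 : z ^ 2 = (m : ℝ) ^ (4 / 5 : ℝ) := by
    rw [hz, ← Real.rpow_natCast, ← Real.rpow_mul hm0.le]; norm_num
  have hz5 : z ^ 5 = (m : ℝ) ^ 2 := by
    rw [hz, ← Real.rpow_natCast, ← Real.rpow_mul hm0.le]; norm_num
  have hz0 : 0 < z := Real.rpow_pos_of_pos hm0 _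
  have hz10 : 10 ≤ z := by
    by_contra h
    have : z ^ 5 ≤ 10 ^ 5 := pow_le_pow_left₀ hz0.le (not_le.1 h).le 5
    nlinarith
  have hD : 1 ≤ ⌊z⌋₊ := Nat.le_floor (by push_cast; linarith)
  have hfl : (⌊z⌋₊ : ℝ) ≤ z := Nat.floor_le hz0.le
  have hlog : 2 / 5 * Real.log m ≤ Real.log (⌊z⌋₊ + 1) := by
    rw [← Real.log_rpow hm0]
    exact Real.log_le_log hz0 (Nat.lt_floor_add_one z).le
  have hlogm : 0 < Real.log m := Real.log_pos (by linarith)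
  have h1 := (Nat.cast_le (α := ℝ)).2 (card_isPrimePow_le_add a m ⌊z⌋₊ ham)
  have h2 := SelbergWeights.card_sifted_le hD a m
  have h3 : (m : ℝ) / Real.log (⌊z⌋₊ + 1) ≤ 5 / 2 * (m / Real.log m) := by
    calc (m : ℝ) / Real.log (⌊z⌋₊ + 1) ≤ m / (2 / 5 * Real.log m) := by gcongr
      _ = _ := by field_simp
  have h4 : (⌊z⌋₊ : ℝ) ^ 2 ≤ z ^ 2 := by gcongr
  push_cast at h1
  rw [← hz2]
  nlinarith

/-! ### Partial summation against `1 / (j + 1/2)` -/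

lemma inv_mul_log_le_log_log_sub {t : ℝ} (ht : 2 < t) :
    1 / (t * Real.log t) ≤ Real.log (Real.log t) - Real.log (Real.log (t - 1)) := by
  have h1 : 0 < Real.log (t - 1) := Real.log_pos (by linarith)
  have h2 : 0 < Real.log t := Real.log_pos (by linarith)
  have h3 := Real.one_sub_inv_le_log_of_pos (div_pos h2 h1)
  rw [Real.log_div h2.ne' h1.ne', inv_div] at h3
  have h4 := Real.one_sub_inv_le_log_of_pos (x := t / (t - 1)) (div_pos (by linarith) (by linarith))
  rw [Real.log_div (by linarith) (by linarith), inv_div] at h4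
  have h5 : 1 / t ≤ Real.log t - Real.log (t - 1) := by
    have : 1 - (t - 1) / t = 1 / t := by field_simp; ring
    linarith
  refine le_trans ?_ h3
  rw [← div_div, one_sub_div h2.ne']
  gcongr

lemma rpow_neg_le_sub {t δ : ℝ} (ht : 1 < t) (hδ : 0 ≤ δ) :
    δ * t ^ (-(1 + δ)) ≤ (t - 1) ^ (-δ) - t ^ (-δ) := by
  have t0 : 0 < t := by linarith
  have t1 : 0 < t - 1 := by linarith
  have h1 : t ^ (-(1 + δ)) = t ^ (-δ) * (1 / t) := by
    rw [one_div, ← Real.rpow_neg_one t, ← Real.rpow_add t0]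
    ring_nf
  have h2 : (t - 1) ^ (-δ) = t ^ (-δ) * (t / (t - 1)) ^ δ := by
    rw [Real.div_rpow t0.le t1.le, Real.rpow_neg t1.le, Real.rpow_neg t0.le]
    have := (Real.rpow_pos_of_pos t0 δ).ne'
    field_simp
  have h3 : 1 + δ * (1 / t) ≤ (t / (t - 1)) ^ δ := by
    rw [Real.rpow_def_of_pos (div_pos t0 t1)]
    have h4 := Real.one_sub_inv_le_log_of_pos (div_pos t0 t1)
    rw [inv_div, one_sub_div t0.ne', sub_sub_cancel] at h4
    have h5 := Real.add_one_le_exp (Real.log (t / (t - 1)) * δ)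
    nlinarith
  rw [h1, h2]
  have h7 := Real.rpow_pos_of_pos t0 (-δ)
  nlinarith

/-- One step of summation by parts, bounded by telescoping differences. The difference of weights is
at most `1 / (m t)` with `t = m - 1/2`, and `11/2` is `11/10` divided by the exponent `1/5`. -/
lemma abel_increment_le {m : ℝ} (hm : 3 ≤ m) :
    (5 / 2 * (m / Real.log m) + 11 / 10 * m ^ (4 / 5 : ℝ))
        * (1 / (m - 1 / 2) - 1 / (m + 1 / 2))
      ≤ 5 / 2 * (Real.log (Real.log (m - 1 / 2)) - Real.log (Real.log (m - 1 / 2 - 1)))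
        + 11 / 2 * ((m - 1 / 2 - 1) ^ (-(1 / 5) : ℝ) - (m - 1 / 2) ^ (-(1 / 5) : ℝ)) := by
  have m0 : 0 < m := by linarith
  obtain ⟨t, ht⟩ : ∃ t, t = m - 1 / 2 := ⟨_, rfl⟩
  rw [← ht]
  have t0 : 0 < t := by linarith
  have h1 := inv_mul_log_le_log_log_sub (t := t) (by linarith)
  have h2 := rpow_neg_le_sub (t := t) (δ := 1 / 5) (by linarith) (by norm_num)
  rw [show (1 + 1 / 5 : ℝ) = 6 / 5 by norm_num] at h2
  have hl : 0 < Real.log t := Real.log_pos (by linarith)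
  have hlm : Real.log t ≤ Real.log m := Real.log_le_log t0 (by linarith)
  have h3 : 1 / t - 1 / (m + 1 / 2) ≤ 1 / (m * t) := by
    have : 1 / t - 1 / (m + 1 / 2) = 1 / ((m + 1 / 2) * t) := by
      rw [show m + 1 / 2 = t + 1 by linarith]
      field_simp
      ring
    rw [this]
    gcongr
    linarith
  have h4 : m / Real.log m * (1 / (m * t)) ≤ 1 / (t * Real.log t) := by
    have : m / Real.log m * (1 / (m * t)) = 1 / (t * Real.log m) := by
      have : Real.log m ≠ 0 := by linarith
      field_simp
    rw [this]
    gcongr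
  have h5 : m ^ (4 / 5 : ℝ) * (1 / (m * t)) ≤ t ^ (-(6 / 5) : ℝ) := by
    have e1 : m ^ (4 / 5 : ℝ) = m * m ^ (-(1 / 5) : ℝ) := by
      rw [← Real.rpow_one_add' m0.le (by norm_num)]; norm_num
    have e2 : t ^ (-(6 / 5) : ℝ) = t ^ (-(1 / 5) : ℝ) * (1 / t) := by
      rw [one_div t, ← Real.rpow_neg_one t, ← Real.rpow_add t0]; norm_num
    have e3 : m * m ^ (-(1 / 5) : ℝ) * (1 / (m * t)) = m ^ (-(1 / 5) : ℝ) * (1 / t) := by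
      field_simp
    rw [e1, e2, e3]
    refine mul_le_mul_of_nonneg_right ?_ (by positivity)
    exact Real.rpow_le_rpow_of_nonpos t0 (by linarith) (by norm_num)
  have h6 : 0 ≤ 5 / 2 * (m / Real.log m) + 11 / 10 * m ^ (4 / 5 : ℝ) := by
    have : 0 ≤ m / Real.log m := div_nonneg m0.le (by linarith)
    positivity
  have h7 := mul_le_mul_of_nonneg_left h3 h6
  nlinarith

lemma sum_inv_add_half_le (n : ℕ) :
    ∑ j ∈ range (n + 1), 1 / ((j : ℝ) + 1 / 2) ≤ 2 + Real.log (n + 1) := by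
  induction n with
  | zero => norm_num
  | succ k ih =>
    rw [sum_range_succ]
    -- The left side is the leading term of the positive series `Real.hasSum_log_one_add_inv`.
    have h1 : 1 / (((k + 1 : ℕ) : ℝ) + 1 / 2) ≤ Real.log (k + 1 + 1) - Real.log (k + 1) := by
      have hk : (0 : ℝ) < k + 1 := by positivity
      have h := Real.hasSum_log_one_add_inv hk
      have h2 := h.summable.sum_le_tsum {0} (fun i _ => by positivity)
      rw [h.tsum_eq, sum_singleton] at h2
      have h3 : 1 + ((k : ℝ) + 1)⁻¹ = (k + 1 + 1) / (k + 1) := by field_simp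
      rw [h3, Real.log_div (by positivity) (by positivity)] at h2
      refine le_trans (le_of_eq ?_) h2
      push_cast
      field_simp
      norm_num
    push_cast at h1 ⊢
    linarith

lemma numeric_start :
    Real.log 400 ≤ 6 ∧ 7 / 4 ≤ Real.log (Real.log (400 - 1 / 2))
      ∧ (400 - 1 / 2 : ℝ) ^ (-(1 / 5) : ℝ) ≤ 31 / 100 := by
  have e1 := Real.exp_one_gt_d9
  have e2 := Real.exp_one_lt_d9
  have hpow : ∀ n : ℕ, Real.exp n = Real.exp 1 ^ n := fun n => by
    rw [← Real.exp_nat_mul, mul_one]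
  refine ⟨?_, ?_, ?_⟩
  · rw [Real.log_le_iff_le_exp (by norm_num)]
    have h := hpow 6
    push_cast at h
    rw [h]
    calc (400 : ℝ) ≤ 2.7182818283 ^ 6 := by norm_num
      _ ≤ _ := by gcongr
  · have h1 : (59 / 10 : ℝ) ≤ Real.log (400 - 1 / 2) := by
      have h : 59 ≤ Real.log ((400 - 1 / 2) ^ 10) := by
        rw [Real.le_log_iff_exp_le (by norm_num)]
        have h := hpow 59
        push_cast at h
        rw [h]
        calc _ ≤ (2.7182818286 : ℝ) ^ 59 := by gcongr
          _ ≤ _ := by norm_num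
      rw [Real.log_pow] at h
      push_cast at h
      linarith
    have h2 : 7 / 4 ≤ Real.log (59 / 10) := by
      have h : 7 ≤ Real.log ((59 / 10) ^ 4) := by
        rw [Real.le_log_iff_exp_le (by norm_num)]
        have h := hpow 7
        push_cast at h
        rw [h]
        calc _ ≤ (2.7182818286 : ℝ) ^ 7 := by gcongr
          _ ≤ _ := by norm_num
      rw [Real.log_pow] at h
      push_cast at h
      linarith
    exact h2.trans (Real.log_le_log (by norm_num) h1)
  · set y : ℝ := (400 - 1 / 2 : ℝ) ^ (-(1 / 5) : ℝ) with hy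
    have hy0 : 0 < y := Real.rpow_pos_of_pos (by norm_num) _
    have hy5 : y ^ 5 = (400 - 1 / 2 : ℝ)⁻¹ := by
      rw [hy, ← Real.rpow_natCast, ← Real.rpow_mul (by norm_num), ← Real.rpow_neg_one]
      norm_num
    by_contra h
    have : (31 / 100 : ℝ) ^ 5 ≤ y ^ 5 := pow_le_pow_left₀ (by norm_num) (not_le.1 h).le 5
    rw [hy5] at this
    norm_num at this

/-- Partial summation: a set of non-negative integers whose counting function satisfies a
Brun–Titchmarsh bound has a small weighted sum of reciprocals. -/
theorem sum_div_add_half_le {q : ℕ → ℝ} (hq1 : ∀ j, q j ≤ 1) {N : ℕ}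
    (hN : 400 ≤ N)
    (hA : ∀ m, 400 ≤ m → m ≤ N → ∑ j ∈ range m, q j
      ≤ 5 / 2 * (m / Real.log m) + 11 / 10 * (m : ℝ) ^ (4 / 5 : ℝ)) :
    ∑ j ∈ range N, q j / ((j : ℝ) + 1 / 2) ≤ 5 / 2 * Real.log (Real.log N) + 27 / 5 := by
  obtain ⟨n1, n2, n3⟩ := numeric_start
  -- Below 400 only `q j ≤ 1` is used: `2 + log 400 - 400/400.5 ≤ 7.01`. Adding the boundary term,
  -- at most 1, the constant is `8.01 - (5/2)(7/4) + (11/2)(31/100) < 27/5`.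
  have key : ∀ n, 400 ≤ n → n ≤ N →
      ∑ j ∈ range n, q j / ((j : ℝ) + 1 / 2) - (∑ j ∈ range n, q j) * (1 / ((n : ℝ) + 1 / 2))
        ≤ 7.01 + 5 / 2 * (Real.log (Real.log (n - 1 / 2))
            - Real.log (Real.log (400 - 1 / 2)))
          + 11 / 2 * ((400 - 1 / 2 : ℝ) ^ (-(1 / 5) : ℝ) - (n - 1 / 2 : ℝ) ^ (-(1 / 5) : ℝ)) := by
    intro n hn
    induction n, hn using Nat.le_induction with
    | base =>
      intro _
      have h1 : ∑ j ∈ range 400, q j / ((j : ℝ) + 1 / 2)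
          - (∑ j ∈ range 400, q j) * (1 / (((400 : ℕ) : ℝ) + 1 / 2))
          ≤ ∑ j ∈ range 400, (1 / ((j : ℝ) + 1 / 2) - 1 / (((400 : ℕ) : ℝ) + 1 / 2)) := by
        rw [sum_mul, ← sum_sub_distrib]
        refine sum_le_sum fun j hj => ?_
        have hj' : (j : ℝ) ≤ (400 : ℕ) := by exact_mod_cast (mem_range.1 hj).le
        have h2 : 1 / (((400 : ℕ) : ℝ) + 1 / 2) ≤ 1 / ((j : ℝ) + 1 / 2) := by gcongr
        have h3 := hq1 j
        rw [div_eq_mul_one_div]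
        nlinarith
      have h4 := sum_inv_add_half_le 399
      rw [sum_sub_distrib, sum_const, card_range] at h1
      norm_num at h1 h4 n1 ⊢
      linarith
    | succ n hn ih =>
      intro hnN
      have ih' := ih (by omega)
      have hn' : (400 : ℝ) ≤ n := by exact_mod_cast hn
      have h1 := abel_increment_le (m := (n : ℝ) + 1) (by linarith)
      have h2 := hA (n + 1) (by omega) hnN
      push_cast at h2 ⊢
      have h3 : 0 ≤ 1 / ((n : ℝ) + 1 - 1 / 2) - 1 / ((n : ℝ) + 1 + 1 / 2) := by
        rw [sub_nonneg]
        refine one_div_le_one_div_of_le ?_ ?_ <;> linarith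
      have h4 := mul_le_mul_of_nonneg_right h2 h3
      have e1 : (n : ℝ) + 1 - 1 / 2 - 1 = n - 1 / 2 := by ring
      have e2 : (n : ℝ) + 1 - 1 / 2 = n + 1 / 2 := by ring
      rw [e1] at h1
      rw [e2] at h1 h4 ⊢
      rw [sum_range_succ, sum_range_succ] at *
      have e3 : q n / ((n : ℝ) + 1 / 2) = q n * (1 / ((n : ℝ) + 1 / 2)) := div_eq_mul_one_div _ _
      rw [e3]
      linarith
  have hN' : (400 : ℝ) ≤ N := by exact_mod_cast hN
  have h1 := key N hN le_rfl
  have h2 : (∑ j ∈ range N, q j) * (1 / ((N : ℝ) + 1 / 2)) ≤ 1 := by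
    have h3 : ∑ j ∈ range N, q j ≤ N := by
      simpa using sum_le_sum (s := range N) fun j _ => hq1 j
    rw [mul_one_div, div_le_one (by linarith)]
    linarith
  have h4 : Real.log (Real.log (N - 1 / 2)) ≤ Real.log (Real.log N) := by
    have : 0 < Real.log ((N : ℝ) - 1 / 2) := Real.log_pos (by linarith)
    exact Real.log_le_log this (Real.log_le_log (by linarith) (by linarith))
  have h5 : 0 ≤ (N - 1 / 2 : ℝ) ^ (-(1 / 5) : ℝ) := Real.rpow_nonneg (by linarith) _
  norm_num at *
  linarith

/-! ### Bounding `-ζ'/ζ` to the right of 1 -/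

open Finset ArithmeticFunction

/-- Telescoping comparison with the integral of `t^(-1-1/l)` over `[1, ∞)`, which equals `l`. -/
lemma le_tsum_one_div_rpow {l : ℝ} (hl : 0 < l) :
    l ≤ ∑' n : ℕ, 1 / (n : ℝ) ^ (1 + 1 / l) := by
  have hs : Summable fun n : ℕ => 1 / (n : ℝ) ^ (1 + 1 / l) :=
    Real.summable_one_div_nat_rpow.2 (by linarith [one_div_pos.2 hl])
  have hstep : ∀ t : ℝ, 1 ≤ t →
      l * (t ^ (-(1 / l)) - (t + 1) ^ (-(1 / l))) ≤ 1 / t ^ (1 + 1 / l) := by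
    intro t ht
    have t0 : 0 < t := by linarith
    have h1 : 1 / t ^ (1 + 1 / l) = t ^ (-(1 / l)) * (1 / t) := by
      rw [one_div t, ← Real.rpow_neg_one t, ← Real.rpow_add t0, one_div (t ^ _),
        ← Real.rpow_neg t0.le]
      ring_nf
    have h2 : (t + 1) ^ (-(1 / l)) = t ^ (-(1 / l)) * (1 + 1 / t) ^ (-(1 / l)) := by
      rw [← Real.mul_rpow t0.le (by positivity)]
      congr 1
      field_simp
    have h3 : 1 - 1 / l * (1 / t) ≤ (1 + 1 / t) ^ (-(1 / l)) := by
      rw [Real.rpow_def_of_pos (by positivity)]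
      have h4 := Real.log_le_sub_one_of_pos (x := 1 + 1 / t) (by positivity)
      have h5 := Real.add_one_le_exp (Real.log (1 + 1 / t) * -(1 / l))
      have h6 : 0 < 1 / l := by positivity
      nlinarith
    rw [h1, h2]
    have h7 := Real.rpow_pos_of_pos t0 (-(1 / l))
    have h8 : t ^ (-(1 / l)) * (1 / t) = l * (t ^ (-(1 / l)) * (1 / l * (1 / t))) := by
      field_simp
    rw [h8]
    gcongr
    nlinarith
  have hpart : ∀ N : ℕ, l * (1 - ((N : ℝ) + 1) ^ (-(1 / l)))
      ≤ ∑ n ∈ range (N + 1), 1 / (n : ℝ) ^ (1 + 1 / l) := by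
    intro N
    induction N with
    | zero =>
      simp only [CharP.cast_eq_zero, zero_add, Real.one_rpow, sub_self, mul_zero, sum_range_one]
      positivity
    | succ k ih =>
      rw [sum_range_succ]
      have := hstep ((k : ℝ) + 1) (by linarith [Nat.cast_nonneg (α := ℝ) k])
      push_cast
      linarith
  have hlim : Filter.Tendsto (fun N : ℕ => l * (1 - ((N : ℝ) + 1) ^ (-(1 / l)))) Filter.atTop
      (nhds (l * (1 - 0))) := by
    refine Filter.Tendsto.const_mul _ (Filter.Tendsto.const_sub _ ?_)
    exact (tendsto_rpow_neg_atTop (one_div_pos.2 hl)).comp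
      (Filter.tendsto_atTop_add_const_right _ _ tendsto_natCast_atTop_atTop)
  rw [sub_zero, mul_one] at hlim
  exact le_of_tendsto' hlim fun N => (hpart N).trans
    (hs.sum_le_tsum _ fun n _ => by positivity)

lemma tsum_one_div_rpow_le {δ : ℝ} (hδ : 0 < δ) :
    ∑' n : ℕ, 1 / (n : ℝ) ^ (1 + δ) ≤ 1 + 1 / δ := by
  have hpart : ∀ N : ℕ, ∑ n ∈ range (N + 2), 1 / (n : ℝ) ^ (1 + δ)
      ≤ 1 + 1 / δ * (1 - ((N : ℝ) + 1) ^ (-δ)) := by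
    intro N
    induction N with
    | zero =>
      have : (0 : ℝ) ^ (1 + δ) = 0 := Real.zero_rpow (by positivity)
      simp [this, sum_range_succ]
    | succ k ih =>
      rw [sum_range_succ]
      have hk : (0 : ℝ) ≤ k := Nat.cast_nonneg _
      have h := rpow_neg_le_sub (t := (k : ℝ) + 2) (δ := δ) (by linarith) hδ.le
      rw [Real.rpow_neg (by linarith) (1 + δ), ← one_div, show (k : ℝ) + 2 - 1 = k + 1 by ring] at h
      have h2 : 1 / ((k : ℝ) + 2) ^ (1 + δ)
          ≤ 1 / δ * (((k : ℝ) + 1) ^ (-δ) - ((k : ℝ) + 2) ^ (-δ)) := by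
        rw [one_div_mul_eq_div, le_div_iff₀ hδ, mul_comm]
        exact h
      push_cast at ih ⊢
      rw [show (k : ℝ) + 1 + 1 = k + 2 by ring]
      linarith
  refine Real.tsum_le_of_sum_range_le (fun n => by positivity) fun N => ?_
  calc _ ≤ ∑ n ∈ range (N + 2), 1 / (n : ℝ) ^ (1 + δ) :=
        sum_le_sum_of_subset_of_nonneg (range_mono (by omega)) fun _ _ _ => by positivity
    _ ≤ _ := hpart N
    _ ≤ _ := by
        have h1 : 0 ≤ ((N : ℝ) + 1) ^ (-δ) := by positivity
        have h2 : 0 < 1 / δ := by positivity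
        nlinarith

/-- Half of the excess exponent pays for the logarithm: `log y ≤ y / e` at `y = n^(1/(2l))`. -/
lemma log_div_rpow_le {l : ℝ} (hl : 0 < l) (n : ℕ) :
    Real.log n / (n : ℝ) ^ (1 + 1 / l)
      ≤ 2 * l / Real.exp 1 * (1 / (n : ℝ) ^ (1 + 1 / (2 * l))) := by
  rcases Nat.eq_zero_or_pos n with rfl | hn
  · simp only [CharP.cast_eq_zero, Real.log_zero, zero_div]
    positivity
  have n0 : (0 : ℝ) < n := by exact_mod_cast hn
  set y : ℝ := (n : ℝ) ^ (1 / (2 * l)) with hy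
  have y0 : 0 < y := Real.rpow_pos_of_pos n0 _
  have h1 : (n : ℝ) ^ (1 + 1 / l) = n ^ (1 + 1 / (2 * l)) * y := by
    rw [hy, ← Real.rpow_add n0]
    congr 1
    field_simp
    ring
  have h2 : Real.log n = 2 * l * Real.log y := by
    rw [hy, Real.log_rpow n0]
    field_simp
  have h3 : Real.log y ≤ y / Real.exp 1 := by
    have h := Real.add_one_le_exp (Real.log y - 1)
    rw [Real.exp_sub, Real.exp_log y0] at h
    linarith
  have h4 : 0 < (n : ℝ) ^ (1 + 1 / (2 * l)) := Real.rpow_pos_of_pos n0 _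
  rw [h1, h2]
  calc 2 * l * Real.log y / ((n : ℝ) ^ (1 + 1 / (2 * l)) * y)
      ≤ 2 * l * (y / Real.exp 1) / ((n : ℝ) ^ (1 + 1 / (2 * l)) * y) := by gcongr
    _ = _ := by field_simp

lemma LSeries_term_ofReal (g : ℕ → ℝ) {c : ℝ} (hc : c ≠ 0) (n : ℕ) :
    LSeries.term (fun n => (g n : ℂ)) c n = ((g n / (n : ℝ) ^ c : ℝ) : ℂ) := by
  rcases Nat.eq_zero_or_pos n with rfl | hn
  · simp [Real.zero_rpow hc]
  · rw [LSeries.term_of_ne_zero hn.ne', Complex.ofReal_div, Complex.ofReal_cpow (Nat.cast_nonneg n),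
      Complex.ofReal_natCast]

lemma LSeries_ofReal (g : ℕ → ℝ) {c : ℝ} (hc : c ≠ 0) :
    LSeries (fun n => (g n : ℂ)) c = ((∑' n : ℕ, g n / (n : ℝ) ^ c : ℝ) : ℂ) := by
  rw [LSeries, Complex.ofReal_tsum]
  exact tsum_congr (LSeries_term_ofReal g hc)

lemma summable_vonMangoldt_div_rpow {c : ℝ} (hc : 1 < c) :
    Summable fun n : ℕ => vonMangoldt n / (n : ℝ) ^ c := by
  have h := LSeriesSummable_vonMangoldt (s := (c : ℂ)) (by simpa using hc)
  have h2 : Summable fun n : ℕ => ((vonMangoldt n / (n : ℝ) ^ c : ℝ) : ℂ) :=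
    h.congr fun n => LSeries_term_ofReal _ (by linarith) n
  exact Complex.summable_ofReal.1 h2

/-- The convolution identity `Λ * 1 = log`, read through real-valued L-series. -/
lemma tsum_vonMangoldt_mul_tsum_one {c : ℝ} (hc : 1 < c) :
    (∑' n : ℕ, vonMangoldt n / (n : ℝ) ^ c) * ∑' n : ℕ, 1 / (n : ℝ) ^ c
      = ∑' n : ℕ, Real.log n / (n : ℝ) ^ c := by
  have c0 : c ≠ 0 := by linarith
  have hre : 1 < (c : ℂ).re := by simpa using hc
  have h1 := LSeries_convolution' (LSeriesSummable_vonMangoldt hre)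
    (LSeriesSummable_one_iff.2 hre)
  rw [convolution_vonMangoldt_const_one] at h1
  have h2 : LSeries (fun n : ℕ => Complex.log n) c
      = LSeries (fun n : ℕ => ((Real.log n : ℝ) : ℂ)) c := by
    congr 1
    ext n
    rw [Complex.natCast_log]
  have h3 : LSeries 1 (c : ℂ) = LSeries (fun _ : ℕ => ((1 : ℝ) : ℂ)) c := by
    congr 1
  rw [h2, h3, LSeries_ofReal _ c0, LSeries_ofReal _ c0, LSeries_ofReal _ c0] at h1
  exact_mod_cast h1.symm

/-- An upper bound for `-ζ'(s) / ζ(s)` at `s = 1 + 1 / l`. -/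
theorem tsum_vonMangoldt_div_rpow_le {l : ℝ} (hl : 0 < l) :
    ∑' n : ℕ, vonMangoldt n / (n : ℝ) ^ (1 + 1 / l) ≤ (4 * l + 2) / Real.exp 1 := by
  have hc : 1 < 1 + 1 / l := by linarith [one_div_pos.2 hl]
  have hδ : 0 < 1 / (2 * l) := by positivity
  have h1 := tsum_vonMangoldt_mul_tsum_one hc
  have hs : Summable fun n : ℕ => 2 * l / Real.exp 1 * (1 / (n : ℝ) ^ (1 + 1 / (2 * l))) :=
    (Real.summable_one_div_nat_rpow.2 (by linarith)).mul_left _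
  have h2 : ∑' n : ℕ, Real.log n / (n : ℝ) ^ (1 + 1 / l)
      ≤ 2 * l / Real.exp 1 * (1 + 1 / (1 / (2 * l))) := by
    have hs' : Summable fun n : ℕ => Real.log n / (n : ℝ) ^ (1 + 1 / l) :=
      Summable.of_nonneg_of_le (fun n => div_nonneg (Real.log_natCast_nonneg n) (by positivity))
        (log_div_rpow_le hl) hs
    refine (hs'.tsum_le_tsum (log_div_rpow_le hl) hs).trans ?_
    rw [tsum_mul_left]
    exact mul_le_mul_of_nonneg_left (tsum_one_div_rpow_le hδ) (by positivity)
  have h3 := le_tsum_one_div_rpow hl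
  have h4 : 0 ≤ ∑' n : ℕ, vonMangoldt n / (n : ℝ) ^ (1 + 1 / l) :=
    tsum_nonneg fun n => div_nonneg vonMangoldt_nonneg (by positivity)
  have h5 := mul_le_mul_of_nonneg_left h3 h4
  have h6 : 2 * l / Real.exp 1 * (1 + 1 / (1 / (2 * l))) = (4 * l + 2) / Real.exp 1 * l := by
    field_simp
    ring
  rw [h1] at h5
  exact le_of_mul_le_mul_right (by linarith) hl

/-! ### Far and near terms of the series -/

open Finset ArithmeticFunction

lemma perronErrorTerm_nonneg {x : ℝ} (hx : 0 ≤ x) (c : ℝ) (n : ℕ) :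
    0 ≤ perronErrorTerm x c n := by
  unfold perronErrorTerm
  have : 0 ≤ vonMangoldt n := vonMangoldt_nonneg
  positivity

lemma perronErrorTerm_far {x c : ℝ} (hx : 0 < x) {n : ℕ}
    (h : (n : ℝ) ≤ x / 2 ∨ 2 * x ≤ n) :
    perronErrorTerm x c n ≤ x ^ c / Real.log 2 * (vonMangoldt n / (n : ℝ) ^ c) := by
  rcases Nat.eq_zero_or_pos n with rfl | hn
  · simp [perronErrorTerm]
  have n0 : (0 : ℝ) < n := by exact_mod_cast hn
  have hl2 : 0 < Real.log 2 := Real.log_pos (by norm_num)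
  have h1 : Real.log 2 ≤ |Real.log (x / n)| := by
    rcases h with h | h
    · refine (Real.log_le_log (by norm_num) ?_).trans (le_abs_self _)
      rw [le_div_iff₀ n0]
      linarith
    · rw [← abs_neg, ← Real.log_inv, inv_div]
      refine (Real.log_le_log (by norm_num) ?_).trans (le_abs_self _)
      rwa [le_div_iff₀ hx]
  have h2 : |Real.log (x / n)|⁻¹ ≤ (Real.log 2)⁻¹ := inv_anti₀ hl2 h1
  have h3 : 0 ≤ vonMangoldt n := vonMangoldt_nonneg
  unfold perronErrorTerm
  calc _ ≤ vonMangoldt n * (x / n) ^ c * (Real.log 2)⁻¹ := by gcongr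
    _ = _ := by
      rw [Real.div_rpow hx.le n0.le]
      ring

open scoped Classical in
lemma vonMangoldt_le_ite (n : ℕ) :
    vonMangoldt n ≤ Real.log n * (if IsPrimePow n then 1 else 0) := by
  split_ifs with h
  · simpa using vonMangoldt_le_log
  · simp [vonMangoldt_eq_zero_iff.2 h]

lemma rpow_mul_inv_abs_log_right {x n c : ℝ} (hx : 0 < x) (hc : 1 ≤ c) (hn : x < n) :
    (x / n) ^ c * |Real.log (x / n)|⁻¹ ≤ x / (n - x) := by
  have n0 : 0 < n := hx.trans hn
  have hh : 0 < n - x := by linarith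
  have h1 : (x / n) ^ c ≤ x / n := by
    have := Real.rpow_le_rpow_of_exponent_ge (div_pos hx n0) ((div_le_one n0).2 hn.le) hc
    rwa [Real.rpow_one] at this
  have h2 : (n - x) / n ≤ |Real.log (x / n)| := by
    rw [← abs_neg, ← Real.log_inv, inv_div]
    refine le_trans ?_ (le_abs_self _)
    have := Real.one_sub_inv_le_log_of_pos (div_pos n0 hx)
    rwa [inv_div, one_sub_div n0.ne'] at this
  calc (x / n) ^ c * |Real.log (x / n)|⁻¹ ≤ x / n * ((n - x) / n)⁻¹ := by
        gcongr
    _ = _ := by field_simp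

/-- Bernoulli gives `(x/n)^(1/l) ≤ 2^(1/l) ≤ 1 + 1/l`. The bound `log u ≥ 2(u-1)/(u+1)` then reduces
the claim to `(x-n)(2n-x) ≥ 0`. -/
lemma rpow_mul_inv_abs_log_left {x n l : ℝ} (hl : 1 ≤ l) (hn : n < x) (hn2 : x ≤ 2 * n) :
    (x / n) ^ (1 + 1 / l) * |Real.log (x / n)|⁻¹ ≤ (1 + 1 / l) * (x / (x - n) + 1) := by
  have n0 : 0 < n := by linarith
  have hx : 0 < x := by linarith
  have hh : 0 < x - n := by linarith
  have l0 : 0 < l := by linarith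
  have h1 : (x / n) ^ (1 + 1 / l) ≤ (x / n) * (1 + 1 / l) := by
    rw [Real.rpow_add (div_pos hx n0), Real.rpow_one]
    gcongr
    calc (x / n) ^ (1 / l) ≤ (1 + 1 : ℝ) ^ (1 / l) := by
          gcongr
          rw [div_le_iff₀ n0]
          linarith
      _ ≤ 1 + 1 / l * 1 := by
          refine rpow_one_add_le_one_add_mul_self (by norm_num) (by positivity) ?_
          rwa [div_le_one l0]
      _ = _ := by ring
  have h2 : 2 * (x - n) / (x + n) ≤ |Real.log (x / n)| := by
    refine le_trans ?_ (le_abs_self _)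
    have := Real.le_log_one_add_of_nonneg (x := (x - n) / n) (by positivity)
    have e1 : 1 + (x - n) / n = x / n := by field_simp; ring
    have e2 : 2 * ((x - n) / n) / ((x - n) / n + 2) = 2 * (x - n) / (x + n) := by
      have : (x - n) / n + 2 = (x + n) / n := by field_simp; ring
      rw [this]
      field_simp
    rwa [e1, e2] at this
  have h3 : x / n * ((2 * (x - n) / (x + n))⁻¹) ≤ x / (x - n) + 1 := by
    rw [inv_div, div_mul_div_comm, div_add_one hh.ne', div_le_div_iff₀ (by positivity) hh]
    have : 0 ≤ (x - n) * ((2 * n - x) * (x - n)) := by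
      have : 0 ≤ 2 * n - x := by linarith
      positivity
    nlinarith
  calc (x / n) ^ (1 + 1 / l) * |Real.log (x / n)|⁻¹
      ≤ (x / n) * (1 + 1 / l) * (2 * (x - n) / (x + n))⁻¹ := by
        gcongr
    _ = (1 + 1 / l) * (x / n * ((2 * (x - n) / (x + n))⁻¹)) := by ring
    _ ≤ _ := by gcongr

lemma log_log_le_of_le {N : ℕ} {x : ℝ} (hN : 400 ≤ N) (h : (N : ℝ) ≤ x) :
    Real.log (Real.log N) ≤ Real.log (Real.log x) := by
  have hN' : (400 : ℝ) ≤ N := by exact_mod_cast hN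
  exact Real.log_le_log (Real.log_pos (by linarith)) (Real.log_le_log (by linarith) h)

/-- The contribution of the integers in `(x, 2x)` for `x = b + 1/2`. -/
lemma sum_perronErrorTerm_right {b : ℕ} {x c : ℝ} (hx : x = b + 1 / 2) (hb : 1000 ≤ b)
    (hc : 1 ≤ c) :
    ∑ n ∈ Ico (b + 1) (2 * b + 1), perronErrorTerm x c n
      ≤ x * (Real.log x + 1) * (5 / 2 * Real.log (Real.log x) + 27 / 5) := by
  classical
  have hb' : (1000 : ℝ) ≤ b := by exact_mod_cast hb
  have hx0 : 0 < x := by linarith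
  have hlog : 0 < Real.log x := Real.log_pos (by linarith)
  have hT := sum_div_add_half_le (q := fun j => if IsPrimePow (b + 1 + j) then 1 else 0) (N := b)
    (fun j => by split_ifs <;> norm_num) (by omega) (fun m hm hmb => by
      have h := card_isPrimePow_le (a := b + 1) hm (by omega)
      rw [card_filter, sum_Ico_eq_sum_range, Nat.add_sub_cancel_left] at h
      push_cast at h
      exact h)
  have hll := log_log_le_of_le (N := b) (x := x) (by omega) (by linarith)
  rw [sum_Ico_eq_sum_range, show 2 * b + 1 - (b + 1) = b by omega]
  calc ∑ j ∈ range b, perronErrorTerm x c (b + 1 + j)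
      ≤ ∑ j ∈ range b, x * (Real.log x + 1)
        * ((if IsPrimePow (b + 1 + j) then 1 else 0) / ((j : ℝ) + 1 / 2)) := by
        refine sum_le_sum fun j hj => ?_
        have hj' : (j : ℝ) + 1 ≤ b := by exact_mod_cast mem_range.1 hj
        have j0 : (0 : ℝ) ≤ j := Nat.cast_nonneg _
        have e : ((b + 1 + j : ℕ) : ℝ) = x + (j + 1 / 2) := by push_cast; linarith
        have h1 := rpow_mul_inv_abs_log_right (n := ((b + 1 + j : ℕ) : ℝ)) hx0 hc
          (by rw [e]; linarith)
        have h2 := vonMangoldt_le_ite (b + 1 + j)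
        have h3 : Real.log ((b + 1 + j : ℕ) : ℝ) ≤ Real.log x + 1 := by
          calc _ ≤ Real.log (2 * x) := Real.log_le_log (by rw [e]; linarith) (by rw [e]; linarith)
            _ = Real.log 2 + Real.log x := Real.log_mul (by norm_num) hx0.ne'
            _ ≤ _ := by linarith [Real.log_two_lt_d9]
        have h4 : ((b + 1 + j : ℕ) : ℝ) - x = j + 1 / 2 := by rw [e]; ring
        rw [h4] at h1
        unfold perronErrorTerm
        rw [mul_assoc]
        calc _ ≤ ((Real.log x + 1) * (if IsPrimePow (b + 1 + j) then 1 else 0))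
              * (x / (j + 1 / 2)) := by
              refine mul_le_mul (h2.trans ?_) h1 (by positivity) ?_
              · exact mul_le_mul_of_nonneg_right h3 (by split_ifs <;> norm_num)
              · exact mul_nonneg (by linarith) (by split_ifs <;> norm_num)
          _ = _ := by ring
    _ = x * (Real.log x + 1) * ∑ j ∈ range b,
        ((if IsPrimePow (b + 1 + j) then 1 else 0) / ((j : ℝ) + 1 / 2)) := by rw [mul_sum]
    _ ≤ _ := by
        refine mul_le_mul_of_nonneg_left ?_ (by positivity)
        linarith

/-- The contribution of the integers in `(x/2, x)` for `x = b + 1/2`. -/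
lemma sum_perronErrorTerm_left {b : ℕ} {x : ℝ} (hx : x = b + 1 / 2) (hb : 1000 ≤ b)
    (hl : 1 ≤ Real.log x) :
    ∑ n ∈ Ico (b / 2 + 1) (b + 1), perronErrorTerm x (1 + 1 / Real.log x) n
      ≤ x * (Real.log x + 1) * (5 / 2 * Real.log (Real.log x) + 6) := by
  classical
  have hb' : (1000 : ℝ) ≤ b := by exact_mod_cast hb
  have hx0 : 0 < x := by linarith
  have hlog : 0 < Real.log x := by linarith
  set N := b - b / 2 with hN
  have hNb : (N : ℝ) ≤ (b + 1) / 2 := by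
    have : 2 * N ≤ b + 1 := by omega
    have : (2 : ℝ) * N ≤ b + 1 := by exact_mod_cast this
    linarith
  -- Here `j` counts downwards from `b`, so the first `m` values fill `[b + 1 - m, b + 1)`. The
  -- sieve's condition `m ≤ a` holds because `2 N ≤ b + 1`.
  have hT := sum_div_add_half_le (q := fun j => if IsPrimePow (b - j) then 1 else 0) (N := N)
    (fun j => by split_ifs <;> norm_num) (by omega) (fun m hm hmN => by
      have h := card_isPrimePow_le (a := b + 1 - m) hm (by omega)
      rw [card_filter, sum_Ico_eq_sum_range, Nat.add_sub_cancel_left, ← sum_range_reflect] at h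
      push_cast at h
      refine le_trans (le_of_eq (sum_congr rfl fun j hj => ?_)) h
      have := mem_range.1 hj
      rw [show b + 1 - m + (m - 1 - j) = b - j by omega])
  have hll := log_log_le_of_le (N := N) (x := x) (by omega) (by linarith)
  have hreflect : ∑ n ∈ Ico (b / 2 + 1) (b + 1), perronErrorTerm x (1 + 1 / Real.log x) n
      = ∑ j ∈ range N, perronErrorTerm x (1 + 1 / Real.log x) (b - j) := by
    rw [sum_Ico_eq_sum_range, ← sum_range_reflect]
    refine sum_congr (by congr 1; omega) fun j hj => ?_
    have := mem_range.1 hj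
    congr 1
    omega
  rw [hreflect]
  calc ∑ j ∈ range N, perronErrorTerm x (1 + 1 / Real.log x) (b - j)
      ≤ ∑ j ∈ range N, (x * (Real.log x + 1)
        * ((if IsPrimePow (b - j) then 1 else 0) / ((j : ℝ) + 1 / 2)) + (Real.log x + 1)) := by
        refine sum_le_sum fun j hj => ?_
        have hj2 := mem_range.1 hj
        have hj' : 2 * (b - j) ≥ b + 1 := by omega
        have hj'' : (2 : ℝ) * ((b - j : ℕ) : ℝ) ≥ b + 1 := by exact_mod_cast hj'
        have j0 : (0 : ℝ) ≤ j := Nat.cast_nonneg _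
        have e : ((b - j : ℕ) : ℝ) = x - (j + 1 / 2) := by
          rw [Nat.cast_sub (by omega)]; linarith
        have h1 := rpow_mul_inv_abs_log_left (n := ((b - j : ℕ) : ℝ)) (x := x) hl
          (by rw [e]; linarith) (by linarith)
        have h2 := vonMangoldt_le_ite (b - j)
        have h3 : Real.log ((b - j : ℕ) : ℝ) ≤ Real.log x :=
          Real.log_le_log (by linarith) (by rw [e]; linarith)
        have h4 : x - ((b - j : ℕ) : ℝ) = j + 1 / 2 := by rw [e]; ring
        rw [h4] at h1
        unfold perronErrorTerm
        rw [mul_assoc]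
        set i : ℝ := if IsPrimePow (b - j) then 1 else 0 with hi
        have i0 : 0 ≤ i := by rw [hi]; split_ifs <;> norm_num
        have i1 : i ≤ 1 := by rw [hi]; split_ifs <;> norm_num
        calc _ ≤ (Real.log x * i)
              * ((1 + 1 / Real.log x) * (x / (j + 1 / 2) + 1)) := by
              refine mul_le_mul (h2.trans ?_) h1 (by positivity) (by positivity)
              exact mul_le_mul_of_nonneg_right h3 i0
          _ = x * (Real.log x + 1) * (i / ((j : ℝ) + 1 / 2)) + (Real.log x + 1) * i := by
              field_simp
          _ ≤ _ := by
              have : (Real.log x + 1) * i ≤ (Real.log x + 1) * 1 := by gcongr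
              linarith
    _ = x * (Real.log x + 1) * ∑ j ∈ range N,
        ((if IsPrimePow (b - j) then 1 else 0) / ((j : ℝ) + 1 / 2))
        + N * (Real.log x + 1) := by
        rw [sum_add_distrib, mul_sum, sum_const, card_range, nsmul_eq_mul]
    -- The `+ 1` in `rpow_mul_inv_abs_log_left`, summed over `N ≤ 3x/5` terms, raises the constant
    -- `27/5` to 6.
    _ ≤ x * (Real.log x + 1) * (5 / 2 * Real.log (Real.log x) + 27 / 5)
        + (3 / 5 * x) * (Real.log x + 1) := by
        gcongr
        · linarith
        · linarith
    _ = _ := by ring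

lemma perronErrorTerm_le_add {b : ℕ} {x c : ℝ} (hx : x = b + 1 / 2) (n : ℕ) :
    perronErrorTerm x c n ≤ x ^ c / Real.log 2 * (vonMangoldt n / (n : ℝ) ^ c)
      + (if n ∈ Ico (b / 2 + 1) (2 * b + 1) then perronErrorTerm x c n else 0) := by
  have hx0 : 0 < x := by rw [hx]; positivity
  split_ifs with h
  · have : 0 ≤ vonMangoldt n := vonMangoldt_nonneg
    have : 0 < Real.log 2 := Real.log_pos (by norm_num)
    exact le_add_of_nonneg_left (by positivity)
  · rw [add_zero]
    refine perronErrorTerm_far hx0 ?_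
    rw [mem_Ico, not_and_or, not_le, not_lt] at h
    rcases h with h | h
    · left
      have h' : 2 * n ≤ b := by omega
      have : (2 : ℝ) * n ≤ b := by exact_mod_cast h'
      linarith
    · right
      have : (2 : ℝ) * b + 1 ≤ n := by exact_mod_cast h
      linarith

lemma rpow_one_add_inv_log {x : ℝ} (hx : 1 < x) :
    x ^ (1 + 1 / Real.log x) = x * Real.exp 1 := by
  have hx0 : 0 < x := by linarith
  have := (Real.log_pos hx).ne'
  rw [Real.rpow_add hx0, Real.rpow_one, Real.rpow_def_of_pos hx0, mul_one_div_cancel this]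

theorem summable_and_tsum_perronErrorTerm_le {b : ℕ} {x : ℝ} (hx : x = b + 1 / 2) (hb : 1000 ≤ b)
    (hl : 1 ≤ Real.log x) :
    Summable (perronErrorTerm x (1 + 1 / Real.log x)) ∧
      ∑' n : ℕ, perronErrorTerm x (1 + 1 / Real.log x) n
        ≤ x * (Real.log x + 1) * (5 * Real.log (Real.log x) + 17.2) := by
  have hb' : (1000 : ℝ) ≤ b := by exact_mod_cast hb
  have hx1 : 1 < x := by linarith
  have hx0 : 0 < x := by linarith
  have l0 : 0 < Real.log x := by linarith
  set c := 1 + 1 / Real.log x with hc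
  have hc1 : 1 < c := by rw [hc]; linarith [one_div_pos.2 l0]
  have s1 : Summable fun n : ℕ => x ^ c / Real.log 2 * (vonMangoldt n / (n : ℝ) ^ c) :=
    (summable_vonMangoldt_div_rpow hc1).mul_left _
  have s2 : HasSum (fun n : ℕ => if n ∈ Ico (b / 2 + 1) (2 * b + 1) then perronErrorTerm x c n
      else 0) (∑ n ∈ Ico (b / 2 + 1) (2 * b + 1), perronErrorTerm x c n) := by
    rw [← sum_congr rfl fun n hn => if_pos (c := n ∈ Ico (b / 2 + 1) (2 * b + 1)) hn]
    exact hasSum_sum_of_ne_finset_zero fun n hn => if_neg hn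
  have hs : Summable (perronErrorTerm x c) :=
    Summable.of_nonneg_of_le (perronErrorTerm_nonneg hx0.le c) (perronErrorTerm_le_add hx)
      (s1.add s2.summable)
  refine ⟨hs, ?_⟩
  have h1 := hs.tsum_le_tsum (perronErrorTerm_le_add hx) (s1.add s2.summable)
  rw [s1.tsum_add s2.summable, s2.tsum_eq, tsum_mul_left] at h1
  rw [← sum_Ico_consecutive _ (show b / 2 + 1 ≤ b + 1 by omega) (show b + 1 ≤ 2 * b + 1 by omega)]
    at h1
  have h2 := sum_perronErrorTerm_left hx hb hl
  have h3 := sum_perronErrorTerm_right hx hb hc1.le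
  have l2 := Real.log_two_gt_d9
  -- The `e` in `x^c = e x` cancels the `1/e` of the `-ζ'/ζ` bound, and `4 / log 2 < 5.8`. In total
  -- `17.2 = 27/5 + 6 + 5.8`.
  have h4 : x ^ c / Real.log 2 * ∑' n : ℕ, vonMangoldt n / (n : ℝ) ^ c
      ≤ x * (Real.log x + 1) * 5.8 := by
    rw [hc, rpow_one_add_inv_log hx1]
    calc _ ≤ x * Real.exp 1 / Real.log 2 * ((4 * Real.log x + 2) / Real.exp 1) := by
          gcongr
          exact tsum_vonMangoldt_div_rpow_le l0
      _ = x * ((4 * Real.log x + 2) / Real.log 2) := by field_simp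
      _ ≤ x * ((Real.log x + 1) * 5.8) := by
          gcongr
          rw [div_le_iff₀ (by linarith)]
          nlinarith
      _ = _ := by ring
  rw [← hc] at h2
  norm_num at h4 ⊢
  linarith

/-! ### Numerical check and conclusion -/

lemma log_ten_gt : 23 / 10 ≤ Real.log 10 := by
  have h : 23 ≤ Real.log (10 ^ 10) := by
    rw [Real.le_log_iff_exp_le (by norm_num)]
    have h := Real.exp_nat_mul 1 23
    rw [mul_one] at h
    push_cast at h
    rw [h]
    calc _ ≤ (2.7182818286 : ℝ) ^ 23 := by
          gcongr
          exact Real.exp_one_lt_d9.le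
      _ ≤ _ := by norm_num
  rw [Real.log_pow] at h
  push_cast at h
  linarith

/-- The inequality is linear in `log l`, and `M ≥ 5.005 = 1.001 * 5` makes it easier as `log l`
grows; checking it at the lower bound `2.3 k` for `log (10^k)` suffices. -/
lemma admissible_bound {L M l : ℝ} (hLM : (L, M) ∈ admissiblePairs) (hl : L ≤ l) :
    1000 ≤ l ∧ 1.001 * (5 * Real.log l + 17.2) < M * Real.log l := by
  have key : ∀ (k : ℕ) (M' : ℝ), L = 10 ^ k → M = M' → 3 ≤ k →
      1.001 * (5 * (k * (23 / 10)) + 17.2) < M' * (k * (23 / 10)) → 5.005 ≤ M' →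
      1000 ≤ l ∧ 1.001 * (5 * Real.log l + 17.2) < M * Real.log l := by
    rintro k M' rfl rfl hk h1 h2
    have h3 : (10 : ℝ) ^ 3 ≤ 10 ^ k := pow_le_pow_right₀ (by norm_num) hk
    have h4 : (k : ℝ) * (23 / 10) ≤ Real.log l := by
      calc (k : ℝ) * (23 / 10) ≤ k * Real.log 10 := by
            gcongr
            exact log_ten_gt
        _ = Real.log (10 ^ k) := (Real.log_pow _ _).symm
        _ ≤ _ := Real.log_le_log (by positivity) hl
    refine ⟨by linarith, ?_⟩
    have h5 := mul_nonneg (sub_nonneg.2 h2) (sub_nonneg.2 h4)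
    norm_num at *
    linarith
  simp only [admissiblePairs, Set.mem_insert_iff, Set.mem_singleton_iff, Prod.mk.injEq] at hLM
  rcases hLM with ⟨h1, h2⟩ | ⟨h1, h2⟩ | ⟨h1, h2⟩ | ⟨h1, h2⟩
  · exact key 3 _ h1 h2 (by norm_num) (by norm_num) (by norm_num)
  · exact key 4 _ h1 h2 (by norm_num) (by norm_num) (by norm_num)
  · exact key 5 _ h1 h2 (by norm_num) (by norm_num) (by norm_num)
  · exact key 6 _ h1 h2 (by norm_num) (by norm_num) (by norm_num)

theorem lemma1 (L M : ℝ) (hLM : (L, M) ∈ admissiblePairs)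
    (x c : ℝ) (hx : IsHalfOddInteger x) (hxK : Real.exp L ≤ x) (hc : c = 1 + 1 / Real.log x) :
    Summable (perronErrorTerm x c) ∧
      ∑' n : ℕ, perronErrorTerm x c n < M * x * Real.log x * Real.log (Real.log x) := by
  have hx0 : 0 < x := (Real.exp_pos L).trans_le hxK
  obtain ⟨hl, hM⟩ := admissible_bound hLM ((Real.le_log_iff_exp_le hx0).2 hxK)
  have hx1000 : 1001 ≤ x := by
    have h1 := Real.add_one_le_exp (Real.log x)
    rw [Real.exp_log hx0] at h1
    linarith
  obtain ⟨k, ⟨i, rfl⟩, hk⟩ := hx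
  push_cast at hk
  have hi : (1000 : ℤ) ≤ i := by
    have : (1000 : ℝ) ≤ i := by linarith
    exact_mod_cast this
  lift i to ℕ using by omega
  have hi' : 1000 ≤ i := by exact_mod_cast hi
  push_cast at hk
  subst hc
  obtain ⟨hs, hle⟩ := summable_and_tsum_perronErrorTerm_le (b := i) (x := x) (by linarith) hi'
    (by linarith)
  refine ⟨hs, hle.trans_lt ?_⟩
  have hll : 0 ≤ Real.log (Real.log x) := Real.log_nonneg (by linarith)
  -- Since `log x ≥ 1000`, the factor `1.001` absorbs the `+ 1`.
  calc x * (Real.log x + 1) * (5 * Real.log (Real.log x) + 17.2)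
      ≤ x * (1.001 * Real.log x) * (5 * Real.log (Real.log x) + 17.2) := by
        gcongr
        norm_num
        linarith
    _ = x * Real.log x * (1.001 * (5 * Real.log (Real.log x) + 17.2)) := by ring
    _ < x * Real.log x * (M * Real.log (Real.log x)) := by
        gcongr
    _ = _ := by ring
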